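/- Let $(X,\mathcal F,\mu)$ be a measure space and let $\mathcal A\subseteq\mathcal F$ be a $\sigma$-subalgebra such that $(X,\mathcal A,\mu|_{\mathcal A})$ is $\sigma$-finite. Let $E=E^{\mathcal A}$ be the conditional expectation with respect to $\mathcal A$, defined for nonnegative $\mathcal F$-measurable functions and, by linearity, for all complex $\mathcal F$-measurable $g$ with $E(|g|)<\infty$ a.e. Let $w,u\ge 0$ be real-valued $\mathcal F$-measurable functions on $X$ with $E(u^2)\in L^\infty(\mathcal A)$, and suppose that $T=M_wEM_u$, $Tf=wE(uf)$, is a bounded operator on the complex Hilbert space $L^2(\mathcal F)$. For a bounded operator $S$ on a complex Hilbert space $\mathcal H$ let $r(S)$ be its spectral radius and, for integers $m\ge1$, put $$d_m=\frac1{\frac1m+r(S)},\qquad R_m(S)=\Bigl(\sum_{n=0}^\infty d_m^{2n}\,S^{*n}S^n\Bigr)^{1/2},$$ and let the spectral radius algebra of $S$ be $$\mathcal B_S=\{Q\in\mathcal B(\mathcal H):\ \sup_{m\ge1}\|R_m(S)\,Q\,R_m(S)^{-1}\|<\infty\}.$$ Let $\widetilde S=|S|^{1/2}U|S|^{1/2}$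 be the Aluthge transform of $S$, where $S=U|S|$ is the polar decomposition ($|S|=(S^*S)^{1/2}$, $U$ the partial isometry with $\ker U=\ker|S|$). If $T=0$ or $r(T)>0$, then $\mathcal B_T=\mathcal B_{\widetilde T}$. -/

import Mathlib

open MeasureTheory
open scoped ENNReal

noncomputable section

namespace WCE

/-! ### Polar decomposition, Aluthge transform and spectral radius algebra -/

section Operators

variable {H : Type*} [NormedAddCommGroup H] [InnerProductSpace ℂ H] [CompleteSpace H]

/-- `U` is the partial isometry of the polar decomposition `T = U|T|`, where
`|T| = (T*T)^{1/2}`: it is isometric on the orthogonal complement of its kernel,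
`T = U|T|`, and `ker U = ker |T|`. -/
structure IsPolarPart (T U : H →L[ℂ] H) : Prop where
  partial_isometry : ∀ x ∈ (LinearMap.ker (U : H →ₗ[ℂ] H))ᗮ, ‖U x‖ = ‖x‖
  eq_mul : T = U * CFC.abs T
  ker_eq : LinearMap.ker (U : H →ₗ[ℂ] H) = LinearMap.ker ((CFC.abs T : H →L[ℂ] H) : H →ₗ[ℂ] H)

theorem norm_abs_apply (T : H →L[ℂ] H) (x : H) : ‖CFC.abs T x‖ = ‖T x‖ := by
  have hsa : ContinuousLinearMap.adjoint (CFC.abs T) = CFC.abs T :=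
    (IsSelfAdjoint.of_nonneg (CFC.abs_nonneg T)).adjoint_eq
  have h : CFC.abs T (CFC.abs T x) = ContinuousLinearMap.adjoint T (T x) := by
    have := congrArg (fun S : H →L[ℂ] H => S x) (CFC.abs_mul_abs T)
    simpa [ContinuousLinearMap.star_eq_adjoint] using this
  have h2 : inner ℂ (CFC.abs T x) (CFC.abs T x) = inner ℂ (T x) (T x) := by
    rw [← ContinuousLinearMap.adjoint_inner_left, hsa, h,
      ContinuousLinearMap.adjoint_inner_left]
  rw [inner_self_eq_norm_sq_to_K, inner_self_eq_norm_sq_to_K] at h2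
  have h3 : ‖CFC.abs T x‖ ^ 2 = ‖T x‖ ^ 2 := by exact_mod_cast h2
  exact (pow_left_inj₀ (norm_nonneg _) (norm_nonneg _) two_ne_zero).1 h3

theorem ker_abs_eq (T : H →L[ℂ] H) :
    LinearMap.ker ((CFC.abs T : H →L[ℂ] H) : H →ₗ[ℂ] H) = (LinearMap.range ((CFC.abs T : H →L[ℂ] H) : H →ₗ[ℂ] H))ᗮ := by
  have hsa : ContinuousLinearMap.adjoint (CFC.abs T) = CFC.abs T :=
    (IsSelfAdjoint.of_nonneg (CFC.abs_nonneg T)).adjoint_eq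
  have := ContinuousLinearMap.orthogonal_range (CFC.abs T)
  rw [hsa] at this
  exact this.symm

/-- Every bounded operator on a Hilbert space has exactly one polar decomposition. -/
theorem existsUnique_isPolarPart (T : H →L[ℂ] H) : ∃! U : H →L[ℂ] H, IsPolarPart T U := by
  set A : H →L[ℂ] H := CFC.abs T with hA
  set K : Submodule ℂ H := (LinearMap.range (A : H →ₗ[ℂ] H)).topologicalClosure with hK
  have hKc : IsClosed (K : Set H) := Submodule.isClosed_topologicalClosure _
  have : CompleteSpace K := hKc.completeSpace_coe
  have hmem : ∀ x, (A : H →ₗ[ℂ] H) x ∈ K := fun x =>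
    Submodule.le_topologicalClosure _ (LinearMap.mem_range_self _ x)
  have hker : LinearMap.ker (A : H →ₗ[ℂ] H) = Kᗮ := by
    rw [hK, Submodule.orthogonal_closure]
    exact ker_abs_eq T
  have hclos : ∀ k ∈ K, k ∈ closure (Set.range A) := by
    intro k hk
    have : k ∈ closure ((LinearMap.range (A : H →ₗ[ℂ] H) : Submodule ℂ H) : Set H) := by
      rw [hK] at hk
      simpa [← Submodule.topologicalClosure_coe] using hk
    exact this
  refine existsUnique_of_exists_of_unique ?_ ?_
  · let e : H →ₗ[ℂ] K := LinearMap.codRestrict K (A : H →ₗ[ℂ] H) hmem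
    have he : DenseRange e := by
      intro k
      rw [closure_subtype]
      have := hclos k k.2
      convert this using 2
      ext y
      constructor
      · rintro ⟨_, ⟨x, rfl⟩, rfl⟩; exact ⟨x, rfl⟩
      · rintro ⟨x, rfl⟩; exact ⟨e x, ⟨x, rfl⟩, rfl⟩
    have hnorm : ∀ x, ‖(T : H →ₗ[ℂ] H) x‖ = ‖e x‖ := fun x => (norm_abs_apply T x).symm
    let V : K →L[ℂ] H := (T : H →ₗ[ℂ] H).extendOfNorm e
    have hV : ∀ x, V (e x) = T x := fun x =>
      LinearMap.extendOfNorm_eq he ⟨1, fun x => by rw [one_mul, hnorm]⟩ x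
    have hVn : ∀ k, ‖V k‖ = ‖k‖ := by
      intro k
      refine he.induction_on (p := fun k => ‖V k‖ = ‖k‖) k ?_ ?_
      · exact isClosed_eq (by fun_prop) (by fun_prop)
      · intro x
        rw [hV]; exact hnorm x
    let U : H →L[ℂ] H := V ∘L K.orthogonalProjectionOnto
    have hUker : LinearMap.ker (U : H →ₗ[ℂ] H) = Kᗮ := by
      ext x
      rw [LinearMap.mem_ker, ← Submodule.orthogonalProjectionOnto_eq_zero_iff]
      change V (K.orthogonalProjectionOnto x) = 0 ↔ _
      rw [← norm_eq_zero, hVn, norm_eq_zero]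
    refine ⟨U, ?_, ?_, ?_⟩
    · intro x hx
      rw [hUker, Submodule.orthogonal_orthogonal] at hx
      change ‖V (K.orthogonalProjectionOnto x)‖ = _
      rw [hVn, Submodule.orthogonalProjectionOnto_mem_subspace_eq_self (⟨x, hx⟩ : K)]
      rfl
    · ext x
      change T x = V (K.orthogonalProjectionOnto (A x))
      have : K.orthogonalProjectionOnto (A x) = e x :=
        Submodule.orthogonalProjectionOnto_mem_subspace_eq_self (e x)
      rw [this, hV]
    · rw [hUker, ← hker]
  · intro U₁ U₂ h₁ h₂
    have hfix : ∀ k ∈ K, U₁ k = U₂ k := by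
      intro k hk
      have hsub : closure (Set.range A) ⊆ {k | U₁ k = U₂ k} := by
        refine closure_minimal ?_ (isClosed_eq U₁.continuous U₂.continuous)
        rintro _ ⟨x, rfl⟩
        have e1 : T x = U₁ (A x) := congrArg (fun S : H →L[ℂ] H => S x) h₁.eq_mul
        have e2 : T x = U₂ (A x) := congrArg (fun S : H →L[ℂ] H => S x) h₂.eq_mul
        exact e1.symm.trans e2
      exact hsub (hclos k hk)
    have hz : ∀ U : H →L[ℂ] H, IsPolarPart T U → ∀ z ∈ Kᗮ, U z = 0 := by
      intro U hU z hz
      rw [← hker, hA, ← hU.ker_eq] at hz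
      exact hz
    ext x
    obtain ⟨y, hy, z, hz', rfl⟩ := K.exists_add_mem_mem_orthogonal (v := x)
    rw [map_add, map_add, hfix y hy, hz U₁ h₁ z hz', hz U₂ h₂ z hz']

/-- The partial isometry `U` in the polar decomposition `T = U|T|`. -/
def polarPart (T : H →L[ℂ] H) : H →L[ℂ] H := (existsUnique_isPolarPart T).choose

theorem isPolarPart_polarPart (T : H →L[ℂ] H) : IsPolarPart T (polarPart T) :=
  (existsUnique_isPolarPart T).choose_spec.1

/-- The Aluthge transform `|T|^{1/2} U |T|^{1/2}`. -/
def aluthge (T : H →L[ℂ] H) : H →L[ℂ] H :=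
  CFC.sqrt (CFC.abs T) * polarPart T * CFC.sqrt (CFC.abs T)

/-- `d_m = 1 / (1/m + r(T))`, with `r(T)` the spectral radius. -/
def dCoeff (T : H →L[ℂ] H) (m : ℕ) : ℝ :=
  1 / (1 / (m : ℝ) + (spectralRadius ℂ T).toReal)

/-- `R_m(T) = (∑ₙ d_m^{2n} (T*)ⁿ Tⁿ)^{1/2}`; for `m ≥ 1` the series converges in norm. -/
def rOp (T : H →L[ℂ] H) (m : ℕ) : H →L[ℂ] H :=
  CFC.sqrt (∑' n : ℕ, ((dCoeff T m ^ (2 * n) : ℝ) : ℂ) • (star T ^ n * T ^ n))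

/-- The spectral radius algebra `B_T`: all bounded `S` with
`sup_{m ≥ 1} ‖R_m S R_m⁻¹‖ < ∞`. -/
def spectralRadiusAlgebra (T : H →L[ℂ] H) : Set (H →L[ℂ] H) :=
  {S | ∃ C : ℝ, ∀ m : ℕ, 1 ≤ m → ‖rOp T m * S * Ring.inverse (rOp T m)‖ ≤ C}

end Operators

/-! ### Weighted conditional expectation operators -/

section CondExp

variable {X : Type*}

/-- Conditional expectation of a real function `g`, as `E(g⁺) - E(g⁻)`, where `E` on
nonnegative functions is the Lebesgue conditional expectation. This makes sense for every `g`
with `E|g| < ∞` a.e.; `g` need not be integrable. -/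
def condER (𝒜 : MeasurableSpace X) {mX : MeasurableSpace X} (μ : Measure X) (g : X → ℝ) (x : X) : ℝ :=
  (condLExp 𝒜 μ (fun y => ENNReal.ofReal (g y)) x).toReal -
    (condLExp 𝒜 μ (fun y => ENNReal.ofReal (-g y)) x).toReal

/-- Conditional expectation of a complex function, through real and imaginary parts. -/
def condE (𝒜 : MeasurableSpace X) {mX : MeasurableSpace X} (μ : Measure X) (g : X → ℂ) (x : X) : ℂ :=
  (condER 𝒜 μ (fun y => (g y).re) x : ℂ) +
    (condER 𝒜 μ (fun y => (g y).im) x : ℂ) * Complex.I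

/-- The bounded operator `T` on `L²(μ)` is the weighted conditional expectation operator
`M_w E M_u`, that is, `T f = w E(u f)` a.e. for every `f ∈ L²(μ)`. -/
def IsWCE (𝒜 : MeasurableSpace X) {mX : MeasurableSpace X} (μ : Measure X)
    (w u : X → ℝ)
    (T : Lp ℂ 2 μ →L[ℂ] Lp ℂ 2 μ) : Prop :=
  ∀ f : Lp ℂ 2 μ, T f =ᵐ[μ] fun x => (w x : ℂ) * condE 𝒜 μ (fun y => (u y : ℂ) * f y) x

end CondExp

end WCE

end

/-!
Put `h = E(uw)`. Pulling the `𝒜`-measurable factor `E(uf)` out of the conditional expectation gives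
`T(Tf) = h · Tf`, and multiplication by any bounded `𝒜`-measurable function commutes with `T`.
Iterating `T` on `{|h| ≥ c}` with `c > ‖T‖` would expand norms by more than `‖T‖`, so `Tf` vanishes
there. Hence `T² = TM`, where `M` is multiplication by a bounded truncation of `h`; being real, it
commutes with `|T|`.

This forces `T̃ = PT`, with `P` the orthogonal projection onto `(ker T)ᗮ`: both operators kill
`ker T = ker |T|^{1/2}`, and they agree on the range of `|T|^{1/2}` because, from the left, `P` and
`|T|^{1/2}` see no difference between `T` and `M`. So `T T̃ⁿ = Tⁿ⁺¹`, and therefore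
`‖T̃ⁿ x‖ ≤ ‖Tⁿ x‖` and `‖Tⁿ⁺¹ x‖ ≤ ‖T‖ ‖T̃ⁿ x‖`. Since `r(T̃) = r(T) > 0` keeps `d_m` bounded by
`1 / r(T)`, comparing `‖R_m x‖² = ∑ d_m²ⁿ ‖Tⁿ x‖²` termwise shows that the norms `‖R_m(T) x‖` and
`‖R_m(T̃) x‖` are equivalent uniformly in `m`, and such families define the same algebra.
-/

namespace WCE

section SpectralRadius

theorem spectralRadius_mul_comm {𝕜 A : Type*} [NormedField 𝕜] [Ring A] [Algebra 𝕜 A] (a b : A) :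
    spectralRadius 𝕜 (a * b) = spectralRadius 𝕜 (b * a) := by
  have le_swap (a b : A) : spectralRadius 𝕜 (a * b) ≤ spectralRadius 𝕜 (b * a) := by
    refine iSup₂_le fun k hk => ?_
    rcases eq_or_ne k 0 with rfl | hk0
    · simp
    · have hk' : k ∈ spectrum 𝕜 (a * b) \ {0} := ⟨hk, hk0⟩
      rw [spectrum.nonzero_mul_comm] at hk'
      exact le_iSup₂ (f := fun k (_ : k ∈ spectrum 𝕜 (b * a)) => (‖k‖₊ : ℝ≥0∞)) k hk'.1
  exact le_antisymm (le_swap a b) (le_swap b a)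

theorem spectralRadius_ne_top {𝕜 A : Type*} [NormedField 𝕜] [NormedRing A] [NormedAlgebra 𝕜 A]
    [CompleteSpace A] (a : A) : spectralRadius 𝕜 a ≠ ∞ :=
  ne_top_of_le_ne_top (by finiteness) (spectrum.spectralRadius_le_pow_nnnorm_pow_one_div 𝕜 a 0)

variable {A : Type*} [NormedRing A] [NormedAlgebra ℂ A] [CompleteSpace A] {a : A}

theorem eventually_norm_pow_le_pow_of_spectralRadius_lt {ρ : ℝ}
    (hρ : spectralRadius ℂ a < ENNReal.ofReal ρ) : ∀ᶠ n : ℕ in Filter.atTop, ‖a ^ n‖ ≤ ρ ^ n := by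
  have hρ0 : 0 < ρ := ENNReal.ofReal_pos.1 (pos_of_gt hρ)
  have gelfand := spectrum.pow_norm_pow_one_div_tendsto_nhds_spectralRadius a
  filter_upwards [gelfand.eventually_lt_const hρ, Filter.eventually_ne_atTop 0] with n hn hn0
  rw [ENNReal.ofReal_lt_ofReal_iff hρ0, one_div] at hn
  rw [← Real.rpow_inv_natCast_pow (norm_nonneg (a ^ n)) hn0]
  exact pow_le_pow_left₀ (by positivity) hn.le n

theorem summable_pow_mul_norm_pow_sq {d : ℝ} (hd0 : 0 ≤ d)
    (hd : d * (spectralRadius ℂ a).toReal < 1) :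
    Summable fun n : ℕ => d ^ (2 * n) * ‖a ^ n‖ ^ 2 := by
  obtain ⟨ρ, hρ, hdρ⟩ : ∃ ρ, (spectralRadius ℂ a).toReal < ρ ∧ d * ρ < 1 := by
    have hcont : ContinuousAt (fun ρ => d * ρ) (spectralRadius ℂ a).toReal := by fun_prop
    exact (hcont.eventually_lt_const hd).exists_gt
  have hρ0 : 0 < ρ := ENNReal.toReal_nonneg.trans_lt hρ
  have hlt : spectralRadius ℂ a < ENNReal.ofReal ρ := by
    rwa [ENNReal.lt_ofReal_iff_toReal_lt (spectralRadius_ne_top a)]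
  refine Summable.of_norm_bounded_eventually_nat (g := fun n => ((d * ρ) ^ 2) ^ n)
    (summable_geometric_of_lt_one (by positivity) (pow_lt_one₀ (by positivity) hdρ two_ne_zero)) ?_
  filter_upwards [eventually_norm_pow_le_pow_of_spectralRadius_lt hlt] with n hn
  calc ‖d ^ (2 * n) * ‖a ^ n‖ ^ 2‖ = d ^ (2 * n) * ‖a ^ n‖ ^ 2 :=
        Real.norm_of_nonneg (by positivity)
    _ ≤ d ^ (2 * n) * (ρ ^ n) ^ 2 := by gcongr
    _ = ((d * ρ) ^ 2) ^ n := by ring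

end SpectralRadius

section SpectralRadiusAlgebra

variable {H : Type*} [NormedAddCommGroup H] [InnerProductSpace ℂ H]

theorem dCoeff_nonneg (T : H →L[ℂ] H) (m : ℕ) : 0 ≤ dCoeff T m := by
  unfold dCoeff; positivity

theorem dCoeff_mul_spectralRadius_lt_one (T : H →L[ℂ] H) {m : ℕ} (hm : 1 ≤ m) :
    dCoeff T m * (spectralRadius ℂ T).toReal < 1 := by
  have hm' : 0 < 1 / (m : ℝ) := by positivity
  rw [dCoeff, one_div_mul_eq_div, div_lt_one (by positivity)]
  linarith

theorem dCoeff_le_inv (T : H →L[ℂ] H) (m : ℕ) (hT : 0 < (spectralRadius ℂ T).toReal) :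
    dCoeff T m ≤ (spectralRadius ℂ T).toReal⁻¹ := by
  rw [dCoeff, one_div]
  gcongr
  exact le_add_of_nonneg_left (by positivity)

theorem dCoeff_congr {S T : H →L[ℂ] H} (h : spectralRadius ℂ S = spectralRadius ℂ T) (m : ℕ) :
    dCoeff S m = dCoeff T m := by
  rw [dCoeff, dCoeff, h]

theorem norm_conj_le_of_norm_apply_le {A B : H →L[ℂ] H} (hA : IsUnit A) (hB : IsUnit B)
    {c₁ c₂ : ℝ} (hc₁ : 0 ≤ c₁) (hc₂ : 0 ≤ c₂) (hAB : ∀ x, ‖A x‖ ≤ c₁ * ‖B x‖)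
    (hBA : ∀ x, ‖B x‖ ≤ c₂ * ‖A x‖) (Q : H →L[ℂ] H) :
    ‖A * Q * Ring.inverse A‖ ≤ c₁ * c₂ * ‖B * Q * Ring.inverse B‖ := by
  refine ContinuousLinearMap.opNorm_le_bound _ (by positivity) fun x => ?_
  have hAx : A (Ring.inverse A x) = x := congrArg (· x) (Ring.mul_inverse_cancel A hA)
  have hBx (y) : Ring.inverse B (B y) = y := congrArg (· y) (Ring.inverse_mul_cancel B hB)
  calc ‖A (Q (Ring.inverse A x))‖ ≤ c₁ * ‖B (Q (Ring.inverse A x))‖ := hAB _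
    _ = c₁ * ‖(B * Q * Ring.inverse B) (B (Ring.inverse A x))‖ := by
      simp only [mul_apply_eq_comp, hBx]
    _ ≤ c₁ * (‖B * Q * Ring.inverse B‖ * ‖B (Ring.inverse A x)‖) := by
      gcongr
      exact ContinuousLinearMap.le_opNorm _ _
    _ ≤ c₁ * (‖B * Q * Ring.inverse B‖ * (c₂ * ‖A (Ring.inverse A x)‖)) := by
      gcongr
      exact hBA _
    _ = c₁ * c₂ * ‖B * Q * Ring.inverse B‖ * ‖x‖ := by rw [hAx]; ring

variable [CompleteSpace H]

theorem summable_dCoeff_smul (T : H →L[ℂ] H) {m : ℕ} (hm : 1 ≤ m) :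
    Summable fun n : ℕ => ((dCoeff T m ^ (2 * n) : ℝ) : ℂ) • (star T ^ n * T ^ n) := by
  refine .of_norm_bounded (summable_pow_mul_norm_pow_sq (dCoeff_nonneg T m)
    (dCoeff_mul_spectralRadius_lt_one T hm)) fun n => ?_
  rw [norm_smul, Complex.norm_real, Real.norm_of_nonneg (pow_nonneg (dCoeff_nonneg T m) _),
    ← star_pow, CStarRing.norm_star_mul_self, sq]

theorem dCoeff_smul_nonneg (T : H →L[ℂ] H) (m n : ℕ) :
    0 ≤ ((dCoeff T m ^ (2 * n) : ℝ) : ℂ) • (star T ^ n * T ^ n) := by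
  rw [Complex.coe_smul, ← star_pow]
  exact smul_nonneg (pow_nonneg (dCoeff_nonneg T m) _) (star_mul_self_nonneg _)

theorem isSelfAdjoint_rOp (T : H →L[ℂ] H) (m : ℕ) : IsSelfAdjoint (rOp T m) :=
  .of_nonneg (CFC.sqrt_nonneg _)

theorem rOp_mul_self (T : H →L[ℂ] H) (m : ℕ) :
    rOp T m * rOp T m = ∑' n : ℕ, ((dCoeff T m ^ (2 * n) : ℝ) : ℂ) • (star T ^ n * T ^ n) :=
  CFC.sqrt_mul_sqrt_self _ (tsum_nonneg fun n => dCoeff_smul_nonneg T m n)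

theorem isUnit_rOp (T : H →L[ℂ] H) {m : ℕ} (hm : 1 ≤ m) : IsUnit (rOp T m) := by
  have one_le : (1 : H →L[ℂ] H) ≤ rOp T m * rOp T m := by
    rw [rOp_mul_self]
    simpa using (summable_dCoeff_smul T hm).le_tsum 0 fun n _ => dCoeff_smul_nonneg T m n
  have hsq : IsUnit (rOp T m * rOp T m) :=
    CStarAlgebra.isUnit_of_le 1 one_le (isUnit_one.isStrictlyPositive zero_le_one)
  exact ((Commute.refl _).isUnit_mul_iff.1 hsq).1

theorem hasSum_norm_rOp_apply_sq (T : H →L[ℂ] H) {m : ℕ} (hm : 1 ≤ m) (x : H) :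
    HasSum (fun n : ℕ => dCoeff T m ^ (2 * n) * ‖(T ^ n) x‖ ^ 2) (‖rOp T m x‖ ^ 2) := by
  have hterm (n : ℕ) : dCoeff T m ^ (2 * n) * ‖(T ^ n) x‖ ^ 2 =
      (inner ℂ x ((((dCoeff T m ^ (2 * n) : ℝ) : ℂ) • (star T ^ n * T ^ n)) x) : ℂ).re := by
    rw [← star_pow, ContinuousLinearMap.star_eq_adjoint, smul_apply,
      inner_smul_right, Complex.re_ofReal_mul,
      ContinuousLinearMap.apply_norm_sq_eq_inner_adjoint_right]
    rfl
  have hsum : ‖rOp T m x‖ ^ 2 = (inner ℂ x ((rOp T m * rOp T m) x) : ℂ).re := by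
    rw [ContinuousLinearMap.apply_norm_sq_eq_inner_adjoint_right,
      (isSelfAdjoint_rOp T m).adjoint_eq]
    rfl
  simp only [hterm, hsum, rOp_mul_self]
  exact (summable_dCoeff_smul T hm).hasSum.mapL (Complex.reCLM ∘L
    (innerSL ℂ x).restrictScalars ℝ ∘L (ContinuousLinearMap.apply ℂ H x).restrictScalars ℝ)

section Comparison

variable {S T : H →L[ℂ] H}

theorem norm_rOp_apply_le {m : ℕ} (hm : 1 ≤ m) (hd : dCoeff S m ≤ dCoeff T m) {x : H}
    (hST : ∀ n, ‖(S ^ n) x‖ ≤ ‖(T ^ n) x‖) : ‖rOp S m x‖ ≤ ‖rOp T m x‖ := by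
  refine (sq_le_sq₀ (norm_nonneg _) (norm_nonneg _)).1 ?_
  refine hasSum_le (fun n => ?_) (hasSum_norm_rOp_apply_sq S hm x) (hasSum_norm_rOp_apply_sq T hm x)
  have hdS := dCoeff_nonneg S m
  have hdT := dCoeff_nonneg T m
  gcongr
  exact hST n

theorem norm_le_norm_rOp_apply (T : H →L[ℂ] H) {m : ℕ} (hm : 1 ≤ m) (x : H) :
    ‖x‖ ≤ ‖rOp T m x‖ := by
  refine (sq_le_sq₀ (norm_nonneg _) (norm_nonneg _)).1 ?_
  have hd0 := dCoeff_nonneg T m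
  simpa using le_hasSum (hasSum_norm_rOp_apply_sq T hm x) 0 fun n _ => by positivity

theorem norm_rOp_apply_le_sqrt_mul {m : ℕ} (hm : 1 ≤ m) (hd : dCoeff T m ≤ dCoeff S m) {K : ℝ}
    {x : H} (hTS : ∀ n, ‖(T ^ (n + 1)) x‖ ≤ K * ‖(S ^ n) x‖) :
    ‖rOp T m x‖ ≤ √(1 + (dCoeff S m * K) ^ 2) * ‖rOp S m x‖ := by
  have hdS := dCoeff_nonneg S m
  have hdT := dCoeff_nonneg T m
  have htail : HasSum (fun n => dCoeff T m ^ (2 * (n + 1)) * ‖(T ^ (n + 1)) x‖ ^ 2)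
      (‖rOp T m x‖ ^ 2 - ‖x‖ ^ 2) := by
    simpa using (hasSum_nat_add_iff' 1).2 (hasSum_norm_rOp_apply_sq T hm x)
  have htail_le : ‖rOp T m x‖ ^ 2 - ‖x‖ ^ 2 ≤ (dCoeff S m * K) ^ 2 * ‖rOp S m x‖ ^ 2 := by
    refine hasSum_le (fun n => ?_) htail ((hasSum_norm_rOp_apply_sq S hm x).mul_left _)
    calc dCoeff T m ^ (2 * (n + 1)) * ‖(T ^ (n + 1)) x‖ ^ 2
        ≤ dCoeff S m ^ (2 * (n + 1)) * (K * ‖(S ^ n) x‖) ^ 2 := by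
          gcongr
          exact hTS n
      _ = (dCoeff S m * K) ^ 2 * (dCoeff S m ^ (2 * n) * ‖(S ^ n) x‖ ^ 2) := by ring
  have hhead : ‖x‖ ^ 2 ≤ ‖rOp S m x‖ ^ 2 := by
    gcongr
    exact norm_le_norm_rOp_apply S hm x
  refine (sq_le_sq₀ (norm_nonneg _) (by positivity)).1 ?_
  rw [mul_pow, Real.sq_sqrt (by positivity)]
  linarith

theorem spectralRadiusAlgebra_subset_of_norm_rOp_apply_le {c₁ c₂ : ℝ} (hc₁ : 0 ≤ c₁) (hc₂ : 0 ≤ c₂)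
    (hST : ∀ m, 1 ≤ m → ∀ x, ‖rOp S m x‖ ≤ c₁ * ‖rOp T m x‖)
    (hTS : ∀ m, 1 ≤ m → ∀ x, ‖rOp T m x‖ ≤ c₂ * ‖rOp S m x‖) :
    spectralRadiusAlgebra S ⊆ spectralRadiusAlgebra T := by
  rintro Q ⟨C, hC⟩
  refine ⟨c₂ * c₁ * C, fun m hm => ?_⟩
  calc ‖rOp T m * Q * Ring.inverse (rOp T m)‖
      ≤ c₂ * c₁ * ‖rOp S m * Q * Ring.inverse (rOp S m)‖ :=
        norm_conj_le_of_norm_apply_le (isUnit_rOp T hm) (isUnit_rOp S hm) hc₂ hc₁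
          (hTS m hm) (hST m hm) Q
    _ ≤ c₂ * c₁ * C := by gcongr; exact hC m hm

theorem spectralRadiusAlgebra_eq_of_norm_pow_apply_le {K : ℝ}
    (hr : spectralRadius ℂ S = spectralRadius ℂ T) (hT : 0 < spectralRadius ℂ T)
    (hST : ∀ n x, ‖(S ^ n) x‖ ≤ ‖(T ^ n) x‖)
    (hTS : ∀ n x, ‖(T ^ (n + 1)) x‖ ≤ K * ‖(S ^ n) x‖) :
    spectralRadiusAlgebra S = spectralRadiusAlgebra T := by
  set r := (spectralRadius ℂ T).toReal
  have hr0 : 0 < r := ENNReal.toReal_pos hT.ne' (spectralRadius_ne_top T)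
  have hle (m : ℕ) (hm : 1 ≤ m) (x : H) : ‖rOp S m x‖ ≤ 1 * ‖rOp T m x‖ := by
    rw [one_mul]
    exact norm_rOp_apply_le hm (dCoeff_congr hr m).le (hST · x)
  have hge (m : ℕ) (hm : 1 ≤ m) (x : H) : ‖rOp T m x‖ ≤ √(1 + (r⁻¹ * K) ^ 2) * ‖rOp S m x‖ := by
    refine (norm_rOp_apply_le_sqrt_mul hm (dCoeff_congr hr m).ge (hTS · x)).trans ?_
    have hd0 := dCoeff_nonneg S m
    have hd : dCoeff S m ≤ r⁻¹ := (dCoeff_congr hr m).trans_le (dCoeff_le_inv T m hr0)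
    rw [mul_pow, mul_pow]
    gcongr
  exact Set.Subset.antisymm
    (spectralRadiusAlgebra_subset_of_norm_rOp_apply_le zero_le_one (by positivity) hle hge)
    (spectralRadiusAlgebra_subset_of_norm_rOp_apply_le (by positivity) zero_le_one hge hle)

end Comparison

end SpectralRadiusAlgebra

section KernelInclusion

theorem mul_eq_mul_of_ker_le {R E : Type*} [Ring R] [AddCommGroup E] [Module R E]
    [TopologicalSpace E] {A B X Y : E →L[R] E} (hker : A.ker ≤ B.ker) (h : A * X = A * Y) :
    B * X = B * Y := by
  ext x
  have hA : X x - Y x ∈ A.ker := by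
    rw [LinearMap.mem_ker, map_sub, sub_eq_zero]
    exact congrArg (· x) h
  have hB := hker hA
  rwa [LinearMap.mem_ker, map_sub, sub_eq_zero] at hB

theorem eq_zero_of_mul_eq_zero_of_ker_le {𝕜 E : Type*} [RCLike 𝕜] [NormedAddCommGroup E]
    [InnerProductSpace 𝕜 E] [CompleteSpace E] {A X : E →L[𝕜] E} (hA : IsSelfAdjoint A)
    (hXA : X * A = 0) (hker : A.ker ≤ X.ker) : X = 0 := by
  have hAX : A * star X = 0 := by
    rw [← star_eq_zero, star_mul, star_star, hA.star_eq, hXA]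
  rw [← CStarRing.mul_star_self_eq_zero_iff]
  exact (mul_eq_mul_of_ker_le hker (hAX.trans (mul_zero A).symm)).trans (mul_zero X)

end KernelInclusion

section Aluthge

variable {H : Type*} [NormedAddCommGroup H] [InnerProductSpace ℂ H] [CompleteSpace H]

variable (T : H →L[ℂ] H)

theorem sqrt_abs_mul_self : CFC.sqrt (CFC.abs T) * CFC.sqrt (CFC.abs T) = CFC.abs T :=
  CFC.sqrt_mul_sqrt_self _ (CFC.abs_nonneg T)

theorem isSelfAdjoint_sqrt_abs : IsSelfAdjoint (CFC.sqrt (CFC.abs T)) :=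
  .of_nonneg (CFC.sqrt_nonneg _)

theorem ker_sqrt_abs : (CFC.sqrt (CFC.abs T)).ker = T.ker := by
  have hker_abs : (CFC.abs T).ker = T.ker := by
    ext x
    simp only [LinearMap.mem_ker, ContinuousLinearMap.coe_coe]
    rw [← norm_eq_zero, norm_abs_apply, norm_eq_zero]
  have hker := ContinuousLinearMap.ker_adjoint_comp_self (CFC.sqrt (CFC.abs T))
  rw [(isSelfAdjoint_sqrt_abs T).adjoint_eq] at hker
  calc (CFC.sqrt (CFC.abs T)).ker
      = (CFC.sqrt (CFC.abs T) * CFC.sqrt (CFC.abs T)).ker := hker.symm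
    _ = T.ker := by rw [sqrt_abs_mul_self, hker_abs]

theorem aluthge_mul_sqrt_abs :
    aluthge T * CFC.sqrt (CFC.abs T) = CFC.sqrt (CFC.abs T) * T := by
  rw [aluthge, mul_assoc, sqrt_abs_mul_self, mul_assoc, ← (isPolarPart_polarPart T).eq_mul]

theorem ker_le_ker_aluthge : T.ker ≤ (aluthge T).ker := by
  intro x hx
  rw [← ker_sqrt_abs] at hx
  have hx' : CFC.sqrt (CFC.abs T) x = 0 := hx
  simp [aluthge, hx']

theorem aluthge_zero : aluthge (0 : H →L[ℂ] H) = 0 := by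
  simp [aluthge]

theorem spectralRadius_aluthge : spectralRadius ℂ (aluthge T) = spectralRadius ℂ T := by
  rw [aluthge, mul_assoc, spectralRadius_mul_comm, mul_assoc, sqrt_abs_mul_self,
    ← (isPolarPart_polarPart T).eq_mul]

theorem ker_starProjection_orthogonal_ker : (T.kerᗮ.starProjection).ker = T.ker := by
  rw [Submodule.ker_starProjection, Submodule.orthogonal_orthogonal_eq_closure]
  exact T.isClosed_ker.submodule_topologicalClosure_eq

theorem mul_starProjection_orthogonal_ker : T * T.kerᗮ.starProjection = T := by
  have hP := (Submodule.isIdempotentElem_starProjection T.kerᗮ).eq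
  have := mul_eq_mul_of_ker_le (ker_starProjection_orthogonal_ker T).le (hP.trans (mul_one _).symm)
  rwa [mul_one] at this

variable {T} {M : H →L[ℂ] H}

theorem commute_abs_of_isSelfAdjoint (hM : IsSelfAdjoint M) (hMT : Commute M T) :
    Commute M (CFC.abs T) :=
  (hMT.symm.cfcAbs_left (hM.star_eq.symm ▸ hMT.symm)).symm

theorem aluthge_eq_starProjection_mul (hM : Commute M (CFC.abs T)) (hT : T * T = T * M) :
    aluthge T = T.kerᗮ.starProjection * T := by
  set s := CFC.sqrt (CFC.abs T)
  set P := T.kerᗮ.starProjection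
  have hs : IsSelfAdjoint s := isSelfAdjoint_sqrt_abs T
  have hMs : M * s = s * M := (hM.symm.cfcₙ_nnreal _).symm
  have hsT : s * T = s * M := mul_eq_mul_of_ker_le (ker_sqrt_abs T).ge hT
  have hPT : P * T = P * M := mul_eq_mul_of_ker_le (ker_starProjection_orthogonal_ker T).ge hT
  have hsP : s * P = s := by
    simpa using mul_eq_mul_of_ker_le (ker_sqrt_abs T).ge
      ((mul_starProjection_orthogonal_ker T).trans (mul_one T).symm)
  have hPs : P * s = s := by
    have := congrArg star hsP
    rwa [star_mul, hs.star_eq, (isSelfAdjoint_starProjection _).star_eq] at this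
  rw [← sub_eq_zero]
  refine eq_zero_of_mul_eq_zero_of_ker_le hs ?_ ?_
  · rw [sub_mul, sub_eq_zero]
    calc aluthge T * s = s * T := aluthge_mul_sqrt_abs T
      _ = P * s * M := by rw [hsT, hPs]
      _ = P * T * s := by rw [hPT, mul_assoc, mul_assoc, hMs]
  · intro x hx
    rw [ker_sqrt_abs] at hx
    have hTx : T x = 0 := hx
    have hax : aluthge T x = 0 := ker_le_ker_aluthge T hx
    simp [hTx, hax]

theorem mul_aluthge_pow (hM : Commute M (CFC.abs T)) (hT : T * T = T * M) (n : ℕ) :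
    T * aluthge T ^ n = T ^ (n + 1) := by
  have hTa : T * aluthge T = T * T := by
    rw [aluthge_eq_starProjection_mul hM hT, ← mul_assoc, mul_starProjection_orthogonal_ker]
  induction n with
  | zero => simp
  | succ n ih => rw [pow_succ' (aluthge T), ← mul_assoc, hTa, mul_assoc, ih, ← pow_succ']

theorem norm_aluthge_pow_apply_le (hM : Commute M (CFC.abs T)) (hT : T * T = T * M) (n : ℕ)
    (x : H) : ‖(aluthge T ^ n) x‖ ≤ ‖(T ^ n) x‖ := by
  cases n with
  | zero => simp
  | succ n =>
    have hpow : aluthge T ^ (n + 1) = T.kerᗮ.starProjection * T ^ (n + 1) := by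
      rw [← mul_aluthge_pow hM hT, pow_succ', ← mul_assoc, ← aluthge_eq_starProjection_mul hM hT]
    rw [hpow]
    exact Submodule.norm_starProjection_apply_le _ _

theorem norm_pow_succ_apply_le (hM : Commute M (CFC.abs T)) (hT : T * T = T * M) (n : ℕ) (x : H) :
    ‖(T ^ (n + 1)) x‖ ≤ ‖T‖ * ‖(aluthge T ^ n) x‖ := by
  rw [← mul_aluthge_pow hM hT]
  exact T.le_opNorm _

theorem spectralRadiusAlgebra_aluthge (hM : Commute M (CFC.abs T)) (hT : T * T = T * M)
    (hr : T ≠ 0 → 0 < spectralRadius ℂ T) :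
    spectralRadiusAlgebra (aluthge T) = spectralRadiusAlgebra T := by
  rcases eq_or_ne T 0 with rfl | hT0
  · rw [aluthge_zero]
  · exact spectralRadiusAlgebra_eq_of_norm_pow_apply_le (spectralRadius_aluthge T) (hr hT0)
      (norm_aluthge_pow_apply_le hM hT) (norm_pow_succ_apply_le hM hT)

end Aluthge

section PullOut

variable {X : Type*} {𝒜 mX : MeasurableSpace X} {μ : Measure X}

theorem condLExp_mul_of_measurable_left (h𝒜 : 𝒜 ≤ mX) [SigmaFinite (μ.trim h𝒜)]
    {k g : X → ℝ≥0∞} (hk : Measurable[𝒜] k) (hg : AEMeasurable g μ) :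
    condLExp 𝒜 μ (fun x => k x * g x) =ᵐ[μ] fun x => k x * condLExp 𝒜 μ g x := by
  have hk' : Measurable k := hk.mono h𝒜 le_rfl
  have trim_eq : (μ.withDensity (condLExp 𝒜 μ g)).trim h𝒜 = (μ.withDensity g).trim h𝒜 := by
    refine @Measure.ext _ 𝒜 _ _ fun s hs => ?_
    rw [trim_measurableSet_eq h𝒜 hs, trim_measurableSet_eq h𝒜 hs, withDensity_apply _ (h𝒜 s hs),
      withDensity_apply _ (h𝒜 s hs), setLIntegral_condLExp h𝒜 μ g hs]
  have setLIntegral_mul {s : Set X} (hs : MeasurableSet[𝒜] s) {f : X → ℝ≥0∞}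
      (hf : AEMeasurable f μ) :
      ∫⁻ x in s, k x * f x ∂μ = ∫⁻ x, s.indicator k x ∂(μ.withDensity f).trim h𝒜 := by
    rw [lintegral_trim h𝒜 (hk.indicator hs),
      lintegral_withDensity_eq_lintegral_mul₀ hf (hk'.indicator (h𝒜 s hs)).aemeasurable,
      ← lintegral_indicator (h𝒜 s hs)]
    congr with x
    by_cases hx : x ∈ s <;> simp [hx, mul_comm]
  refine (ae_eq_condLExp h𝒜 μ _ (hk.mul (measurable_condLExp _ _ _)) fun s hs => ?_).symm
  calc ∫⁻ x in s, k x * condLExp 𝒜 μ g x ∂μ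
      = ∫⁻ x, s.indicator k x ∂(μ.withDensity (condLExp 𝒜 μ g)).trim h𝒜 :=
        setLIntegral_mul hs (measurable_condLExp' _ _ _).aemeasurable
    _ = ∫⁻ x in s, k x * g x ∂μ := by rw [trim_eq, setLIntegral_mul hs hg]

theorem condLExp_ofReal_mul_of_measurable_left (h𝒜 : 𝒜 ≤ mX) [SigmaFinite (μ.trim h𝒜)]
    {k g : X → ℝ} (hk : Measurable[𝒜] k) (hg : AEMeasurable g μ) :
    condLExp 𝒜 μ (fun x => ENNReal.ofReal (k x * g x)) =ᵐ[μ] fun x =>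
      ENNReal.ofReal (k x) * condLExp 𝒜 μ (fun y => ENNReal.ofReal (g y)) x +
        ENNReal.ofReal (-k x) * condLExp 𝒜 μ (fun y => ENNReal.ofReal (-g y)) x := by
  have hk' : Measurable k := hk.mono h𝒜 le_rfl
  have posPart_mul : (fun x => ENNReal.ofReal (k x * g x)) =
      (fun x => ENNReal.ofReal (k x) * ENNReal.ofReal (g x)) +
        fun x => ENNReal.ofReal (-k x) * ENNReal.ofReal (-g x) := by
    ext x
    rcases le_total 0 (k x) with h | h
    · simp [ENNReal.ofReal_mul h, ENNReal.ofReal_of_nonpos (neg_nonpos.2 h)]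
    · simp [← ENNReal.ofReal_mul (neg_nonneg.2 h), ENNReal.ofReal_of_nonpos h]
  rw [posPart_mul]
  filter_upwards [condLExp_add_left (mΩ := 𝒜) (P := μ)
      (fun x => ENNReal.ofReal (-k x) * ENNReal.ofReal (-g x))
      (hk'.ennreal_ofReal.aemeasurable.mul hg.ennreal_ofReal),
    condLExp_mul_of_measurable_left h𝒜 hk.ennreal_ofReal hg.ennreal_ofReal,
    condLExp_mul_of_measurable_left h𝒜 hk.neg.ennreal_ofReal hg.neg.ennreal_ofReal]
    with x hadd hpos hneg
  exact hadd.trans (congrArg₂ (· + ·) hpos hneg)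

theorem condER_congr_ae {g g' : X → ℝ} (h : g =ᵐ[μ] g') : condER 𝒜 μ g =ᵐ[μ] condER 𝒜 μ g' := by
  filter_upwards [condLExp_congr_ae (mΩ := 𝒜) (h.fun_comp ENNReal.ofReal),
    condLExp_congr_ae (mΩ := 𝒜) (h.fun_comp fun y => ENNReal.ofReal (-y))] with x hpos hneg
  exact congrArg₂ (fun a b : ℝ≥0∞ => a.toReal - b.toReal) hpos hneg

theorem measurable_condER (g : X → ℝ) : Measurable[𝒜] (condER 𝒜 μ g) :=
  (measurable_condLExp 𝒜 μ _).ennreal_toReal.sub (measurable_condLExp 𝒜 μ _).ennreal_toReal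

theorem condER_mul_of_measurable_left (h𝒜 : 𝒜 ≤ mX) [SigmaFinite (μ.trim h𝒜)] {k g : X → ℝ}
    (hk : Measurable[𝒜] k) (hg : AEMeasurable g μ) :
    condER 𝒜 μ (fun x => k x * g x) =ᵐ[μ] fun x => k x * condER 𝒜 μ g x := by
  filter_upwards [condLExp_ofReal_mul_of_measurable_left h𝒜 hk hg,
    condLExp_ofReal_mul_of_measurable_left h𝒜 hk hg.neg] with x hpos hneg
  simp only [Pi.neg_apply, mul_neg, neg_neg] at hneg
  simp only [condER, hpos, hneg]
  rcases le_total 0 (k x) with h | h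
  · simp only [ENNReal.ofReal_of_nonpos (neg_nonpos.2 h), zero_mul, add_zero, ENNReal.toReal_mul,
      ENNReal.toReal_ofReal h, mul_sub]
  · simp only [ENNReal.ofReal_of_nonpos h, zero_mul, zero_add, ENNReal.toReal_mul,
      ENNReal.toReal_ofReal (neg_nonneg.2 h)]
    ring

theorem condE_congr_ae {g g' : X → ℂ} (h : g =ᵐ[μ] g') : condE 𝒜 μ g =ᵐ[μ] condE 𝒜 μ g' := by
  filter_upwards [condER_congr_ae (𝒜 := 𝒜) (h.fun_comp Complex.re),
    condER_congr_ae (𝒜 := 𝒜) (h.fun_comp Complex.im)] with x hre him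
  exact congrArg₂ (fun a b : ℝ => (a : ℂ) + b * Complex.I) hre him

theorem measurable_condE (g : X → ℂ) : Measurable[𝒜] (condE 𝒜 μ g) :=
  (Complex.measurable_ofReal.comp (measurable_condER _)).add
    ((Complex.measurable_ofReal.comp (measurable_condER _)).mul_const _)

theorem condE_ofReal_mul_of_measurable_left (h𝒜 : 𝒜 ≤ mX) [SigmaFinite (μ.trim h𝒜)]
    {k : X → ℝ} {g : X → ℂ} (hk : Measurable[𝒜] k) (hg : AEMeasurable g μ) :
    condE 𝒜 μ (fun x => (k x : ℂ) * g x) =ᵐ[μ] fun x => (k x : ℂ) * condE 𝒜 μ g x := by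
  filter_upwards [condER_mul_of_measurable_left h𝒜 hk hg.re,
    condER_mul_of_measurable_left h𝒜 hk hg.im] with x hre him
  simp only [RCLike.re_eq_complex_re, RCLike.im_eq_complex_im] at hre him
  simp only [condE, Complex.re_ofReal_mul, Complex.im_ofReal_mul, hre, him]
  push_cast
  ring

theorem condE_mul_ofReal_of_measurable_left (h𝒜 : 𝒜 ≤ mX) [SigmaFinite (μ.trim h𝒜)]
    {k : X → ℂ} {g : X → ℝ} (hk : Measurable[𝒜] k) (hg : AEMeasurable g μ) :
    condE 𝒜 μ (fun x => k x * (g x : ℂ)) =ᵐ[μ] fun x => k x * (condER 𝒜 μ g x : ℂ) := by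
  filter_upwards [condER_mul_of_measurable_left h𝒜 (Complex.measurable_re.comp hk) hg,
    condER_mul_of_measurable_left h𝒜 (Complex.measurable_im.comp hk) hg] with x hre him
  simp only [Function.comp_apply] at hre him
  simp only [condE, Complex.re_mul_ofReal, Complex.im_mul_ofReal, hre, him]
  push_cast
  linear_combination (condER 𝒜 μ g x : ℂ) * Complex.re_add_im (k x)

end PullOut

section MultiplicationOp

variable {X 𝕜 : Type*} {mX : MeasurableSpace X} {μ : Measure X} [RCLike 𝕜] {ψ : X → 𝕜}

/-- Multiplication by an essentially bounded function `ψ`, as a bounded operator on `Lᵖ(μ)`. -/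
noncomputable def multiplicationOp (p : ℝ≥0∞) [Fact (1 ≤ p)] (hψ : MemLp ψ ∞ μ) :
    Lp 𝕜 p μ →L[𝕜] Lp 𝕜 p μ :=
  (ContinuousLinearMap.mul 𝕜 𝕜).holderL μ ∞ p p (hψ.toLp ψ)

theorem coeFn_multiplicationOp {p : ℝ≥0∞} [Fact (1 ≤ p)] (hψ : MemLp ψ ∞ μ) (f : Lp 𝕜 p μ) :
    multiplicationOp p hψ f =ᵐ[μ] fun x => ψ x * f x := by
  filter_upwards [(ContinuousLinearMap.mul 𝕜 𝕜).coeFn_holder (r := p) (hψ.toLp ψ) f,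
    hψ.coeFn_toLp] with x hmul hψx
  refine hmul.trans ?_
  rw [hψx, ContinuousLinearMap.mul_apply']

theorem isSelfAdjoint_multiplicationOp (hψ : MemLp ψ ∞ μ)
    (hψ_real : ∀ᵐ x ∂μ, IsSelfAdjoint (ψ x)) : IsSelfAdjoint (multiplicationOp 2 hψ) := by
  refine ContinuousLinearMap.isSelfAdjoint_iff_isSymmetric.2 fun f g => ?_
  simp only [ContinuousLinearMap.coe_coe, L2.inner_def]
  refine integral_congr_ae ?_
  filter_upwards [coeFn_multiplicationOp hψ f, coeFn_multiplicationOp hψ g, hψ_real]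
    with x hf hg hreal
  rw [hf, hg, RCLike.inner_apply, RCLike.inner_apply, map_mul, starRingEnd_apply, hreal.star_eq]
  ring

end MultiplicationOp

section WeightedConditionalExpectation

theorem eq_zero_of_opNorm_lt_of_mul_norm_le {𝕜 E F : Type*} [NontriviallyNormedField 𝕜]
    [NormedAddCommGroup E] [NormedSpace 𝕜 E] [SeminormedAddCommGroup F] [NormedSpace 𝕜 F]
    {T : E →L[𝕜] F} {c : ℝ} (hc : ‖T‖ < c) {x : E} (hx : c * ‖x‖ ≤ ‖T x‖) : x = 0 := by
  by_contra hx0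
  have hlt : ‖T‖ * ‖x‖ < c * ‖x‖ := by gcongr
  exact (hlt.trans_le hx).not_ge (T.le_opNorm x)

variable {X : Type*} {𝒜 mX : MeasurableSpace X} {μ : Measure X} {w u : X → ℝ}
  {T : Lp ℂ 2 μ →L[ℂ] Lp ℂ 2 μ}

theorem IsWCE.apply_apply (h𝒜 : 𝒜 ≤ mX) [SigmaFinite (μ.trim h𝒜)] (hw : AEMeasurable w μ)
    (hu : AEMeasurable u μ) (hT : IsWCE 𝒜 μ w u T) (f : Lp ℂ 2 μ) :
    T (T f) =ᵐ[μ] fun x => (condER 𝒜 μ (u * w) x : ℂ) * T f x := by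
  set k := condE 𝒜 μ fun y => (u y : ℂ) * f y
  have hk : Measurable[𝒜] k := measurable_condE _
  have hmul : (fun y => (u y : ℂ) * T f y) =ᵐ[μ] fun y => k y * ((u * w) y : ℝ) := by
    filter_upwards [hT f] with y hy
    rw [hy, Pi.mul_apply, Complex.ofReal_mul]
    ring
  filter_upwards [hT (T f), hT f, condE_congr_ae (𝒜 := 𝒜) hmul,
    condE_mul_ofReal_of_measurable_left h𝒜 hk (hu.mul hw)] with x hTTf hTf hcongr hpull
  rw [hTTf, hcongr, hpull, hTf]
  ring

theorem IsWCE.apply_of_ae_eq_mul (h𝒜 : 𝒜 ≤ mX) [SigmaFinite (μ.trim h𝒜)] (hu : AEMeasurable u μ)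
    (hT : IsWCE 𝒜 μ w u T) {ψ : X → ℝ} (hψ : Measurable[𝒜] ψ) {f g : Lp ℂ 2 μ}
    (hg : g =ᵐ[μ] fun x => (ψ x : ℂ) * f x) : T g =ᵐ[μ] fun x => (ψ x : ℂ) * T f x := by
  have hmul : (fun y => (u y : ℂ) * g y) =ᵐ[μ] fun y => (ψ y : ℂ) * ((u y : ℂ) * f y) := by
    filter_upwards [hg] with y hy
    rw [hy]
    ring
  have huf : AEMeasurable (fun y => (u y : ℂ) * f y) μ :=
    (Complex.measurable_ofReal.comp_aemeasurable hu).mul (Lp.aestronglyMeasurable f).aemeasurable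
  filter_upwards [hT g, hT f, condE_congr_ae (𝒜 := 𝒜) hmul,
    condE_ofReal_mul_of_measurable_left h𝒜 hψ huf] with x hTg hTf hcongr hpull
  rw [hTg, hcongr, hpull, hTf]
  ring

theorem IsWCE.ae_apply_eq_zero_of_opNorm_lt (h𝒜 : 𝒜 ≤ mX) [SigmaFinite (μ.trim h𝒜)]
    (hw : AEMeasurable w μ) (hu : AEMeasurable u μ) (hT : IsWCE 𝒜 μ w u T) {c : ℝ} (hc : ‖T‖ < c)
    (f : Lp ℂ 2 μ) :
    ∀ᵐ x ∂μ, c ≤ |condER 𝒜 μ (u * w) x| → T f x = 0 := by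
  set h := condER 𝒜 μ (u * w)
  have hh : Measurable[𝒜] h := measurable_condER _
  set B : Set X := {x | c ≤ |h x|}
  have hB : MeasurableSet[𝒜] B := (continuous_abs.measurable.comp hh) measurableSet_Ici
  have hχ : Measurable[𝒜] (B.indicator (1 : X → ℝ)) := (@measurable_one ℝ X _ 𝒜 _).indicator hB
  have hc0 : 0 < c := (norm_nonneg T).trans_lt hc
  set g : Lp ℂ 2 μ := ((Lp.memLp f).indicator (h𝒜 B hB)).toLp _
  have hg : g =ᵐ[μ] fun x => ((B.indicator 1 x : ℝ) : ℂ) * f x := by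
    filter_upwards [((Lp.memLp f).indicator (h𝒜 B hB)).coeFn_toLp] with x hx
    by_cases hxB : x ∈ B <;> simp [g, hx, hxB]
  have hTg := hT.apply_of_ae_eq_mul h𝒜 hu hχ hg
  have expand : c * ‖T g‖ ≤ ‖T (T g)‖ := by
    have hle : ∀ᵐ x ∂μ, ‖T g x‖ ≤ c⁻¹ * ‖T (T g) x‖ := by
      filter_upwards [hTg, hT.apply_apply h𝒜 hw hu g] with x hx hxx
      by_cases hxB : x ∈ B
      · rw [hxx, norm_mul, Complex.norm_real, Real.norm_eq_abs, ← mul_assoc, inv_mul_eq_div]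
        exact le_mul_of_one_le_left (norm_nonneg _) ((one_le_div hc0).2 hxB)
      · simp [hx, hxx, hxB]
    have := Lp.norm_le_mul_norm_of_ae_le_mul hle
    rwa [inv_mul_eq_div, le_div_iff₀' hc0] at this
  have hTg0 : T g = 0 := eq_zero_of_opNorm_lt_of_mul_norm_le hc expand
  filter_upwards [hTg, Lp.coeFn_zero ℂ 2 μ] with x hx h0 hxB
  rw [hTg0, h0] at hx
  simpa [show x ∈ B from hxB] using hx.symm

theorem IsWCE.exists_isSelfAdjoint_commute (h𝒜 : 𝒜 ≤ mX) [SigmaFinite (μ.trim h𝒜)]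
    (hw : AEMeasurable w μ) (hu : AEMeasurable u μ) (hT : IsWCE 𝒜 μ w u T) :
    ∃ M : Lp ℂ 2 μ →L[ℂ] Lp ℂ 2 μ, IsSelfAdjoint M ∧ Commute M T ∧ T * T = T * M := by
  set h := condER 𝒜 μ (u * w)
  have hh : Measurable[𝒜] h := measurable_condER _
  set c := ‖T‖ + 1
  have hc : ‖T‖ < c := lt_add_one _
  set B : Set X := {x | |h x| < c}
  have hB : MeasurableSet[𝒜] B := (continuous_abs.measurable.comp hh) measurableSet_Iio
  set ψ : X → ℝ := B.indicator h
  have hψ : Measurable[𝒜] ψ := hh.indicator hB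
  have hψ_le (x : X) : ‖(ψ x : ℂ)‖ ≤ c := by
    rw [Complex.norm_real, Real.norm_eq_abs]
    by_cases hx : x ∈ B
    · simpa [ψ, hx] using le_of_lt hx
    · simpa [ψ, hx] using (norm_nonneg T).trans hc.le
  have hψ_memLp : MemLp (fun x => (ψ x : ℂ)) ∞ μ :=
    memLp_top_of_bound (Complex.measurable_ofReal.comp
      (hψ.mono h𝒜 le_rfl)).aestronglyMeasurable c (.of_forall hψ_le)
  have hM := coeFn_multiplicationOp (p := 2) hψ_memLp
  have hTM (f : Lp ℂ 2 μ) := hT.apply_of_ae_eq_mul h𝒜 hu hψ (hM f)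
  refine ⟨multiplicationOp 2 hψ_memLp,
    isSelfAdjoint_multiplicationOp hψ_memLp (.of_forall fun x => Complex.conj_ofReal _),
    ContinuousLinearMap.ext fun f => Lp.ext ((hM (T f)).trans (hTM f).symm),
    ContinuousLinearMap.ext fun f => Lp.ext ?_⟩
  filter_upwards [hT.apply_apply h𝒜 hw hu f, hTM f,
    hT.ae_apply_eq_zero_of_opNorm_lt h𝒜 hw hu hc f] with x hTT hTMx hzero
  refine hTT.trans (Eq.trans ?_ hTMx.symm)
  by_cases hx : x ∈ B
  · simp [ψ, h, hx]
  · simp [hzero (not_lt.1 hx)]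

end WeightedConditionalExpectation

end WCE

theorem mainTheorem4_general {X : Type*} (𝒜 : MeasurableSpace X) {mX : MeasurableSpace X}
    (μ : Measure X) (h𝒜 : 𝒜 ≤ mX) [SigmaFinite (μ.trim h𝒜)]
    (w u : X → ℝ) (hw : AEMeasurable w μ) (hu : AEMeasurable u μ)
    (T : Lp ℂ 2 μ →L[ℂ] Lp ℂ 2 μ) (hT : WCE.IsWCE 𝒜 μ w u T)
    (hr : T ≠ 0 → 0 < spectralRadius ℂ T) :
    WCE.spectralRadiusAlgebra T = WCE.spectralRadiusAlgebra (WCE.aluthge T) := by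
  obtain ⟨M, hM, hMT, hTT⟩ := hT.exists_isSelfAdjoint_commute h𝒜 hw hu
  exact (WCE.spectralRadiusAlgebra_aluthge (WCE.commute_abs_of_isSelfAdjoint hM hMT) hTT hr).symm

theorem mainTheorem4 {X : Type*} (𝒜 : MeasurableSpace X) {mX : MeasurableSpace X}
    (μ : Measure X) (h𝒜 : 𝒜 ≤ mX) [SigmaFinite (μ.trim h𝒜)]
    (w u : X → ℝ) (hw : Measurable w) (hu : Measurable u)
    (hw0 : 0 ≤ᵐ[μ] w) (hu0 : 0 ≤ᵐ[μ] u)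
    (hu2 : essSup (condLExp 𝒜 μ (fun x => ENNReal.ofReal (u x ^ 2))) μ < ∞)
    (T : Lp ℂ 2 μ →L[ℂ] Lp ℂ 2 μ) (hT : WCE.IsWCE 𝒜 μ w u T)
    (hr : T ≠ 0 → 0 < spectralRadius ℂ T) :
    WCE.spectralRadiusAlgebra T = WCE.spectralRadiusAlgebra (WCE.aluthge T) :=
  mainTheorem4_general 𝒜 μ h𝒜 w u hw.aemeasurable hu.aemeasurable T hT hr
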